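/- Let $\mathbb{C}$ be a regular category, i.e. a category with finite limits in which every morphism factors as a regular epimorphism followed by a monomorphism and in which regular epimorphisms are stable under pullback. A relation on an object $X$ is a subobject $\langle r_1,r_2\rangle\colon R\rightarrowtail X\times X$; relations are ordered as subobjects, $R\wedge S$ denotes the intersection, $R^\circ=\langle r_2,r_1\rangle$ the opposite relation, and $SR$ (first $R$, then $S$) the relational composite, i.e. the image of $\langle r_1\pi_1,s_2\pi_2\rangle\colon R\times_X S\to X\times X$, where $\pi_1,\pi_2$ are the projections of the pullback of $r_2$ and $s_1$. A relation $R$ on $X$ is reflexive if $1_X\leqslant R$, where $1_X$ is the diagonal $\langle 1_X,1_X\rangle\colon X\rightarrowtail X\times X$, and it is an equivalence relation if moreover $R^\circ\leqslant R$ and $RR\leqslant R$. For generalized elements $x,y\colon W\to X$, write $(x,y)\in R$ if $\langle x,y\rangle\colon W\to X\times X$ factors through $R$. Suppose that $\mathbb{C}$ is a Goursat category, i.e. $RSR=SRS$ for any two equivalence relations $R,S$ on the same object of $\mathbb{C}$. Then the Shifting Lemma holds in $\mathbb{C}$ when $S$ is a reflexive relation and $R$ and $T$ are equivalence relations: let $R$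 and $T$ be equivalence relations and $S$ a reflexive relation on an object $X$ of $\mathbb{C}$ such that $R\wedge S\leqslant T$. Then for every object $W$ and all morphisms $x,y,u,v\colon W\to X$ with $$(x,y)\in R\wedge T,\qquad (x,u)\in S,\qquad (y,v)\in S,\qquad (u,v)\in R,$$ one has $(u,v)\in T$. -/

import Mathlib

open CategoryTheory CategoryTheory.Limits

universe v u

noncomputable section

namespace RegularRel

variable {C : Type u} [Category.{v} C] [Regular C]

/-- An internal relation `⟨r₁, r₂⟩ : R ↣ X × Y` from `X` to `Y`. -/
abbrev Rel (X Y : C) : Type (max u v) := Subobject (X ⨯ Y)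

variable {X Y Z : C}

/-- The first projection `r₁ : R ⟶ X` of a relation from `X` to `Y`. -/
abbrev Rel.fst (R : Rel X Y) : (R : C) ⟶ X := R.arrow ≫ prod.fst

/-- The second projection `r₂ : R ⟶ Y` of a relation from `X` to `Y`. -/
abbrev Rel.snd (R : Rel X Y) : (R : C) ⟶ Y := R.arrow ≫ prod.snd

/-- Generalised elements `x : W ⟶ X` and `y : W ⟶ Y` are related by `R`, written `(x, y) ∈ R`:
the morphism `⟨x, y⟩ : W ⟶ X × Y` factors through `R`. -/
def Rel.Mem (R : Rel X Y) {W : C} (x : W ⟶ X) (y : W ⟶ Y) : Prop :=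
  R.Factors (prod.lift x y)

instance Rel.mono_lift_snd_fst (R : Rel X Y) : Mono (prod.lift R.snd R.fst) := by
  have h : prod.lift R.snd R.fst = R.arrow ≫ (prod.braiding X Y).hom := by
    ext <;> simp
  rw [h]
  infer_instance

/-- The opposite relation `R°`, given by `⟨r₂, r₁⟩ : R ↣ Y × X`. -/
def Rel.opposite (R : Rel X Y) : Rel Y X :=
  Subobject.mk (prod.lift R.snd R.fst)

/-- The relational composite `SR` (first `R`, then `S`): the image of
`⟨r₁ π₁, s₂ π₂⟩ : R ×_Y S ⟶ X × Z`. In a regular category images are given by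
(regular epimorphism, monomorphism) factorisations. -/
def Rel.comp (S : Rel Y Z) (R : Rel X Y) : Rel X Z :=
  imageSubobject (prod.lift (pullback.fst R.snd S.fst ≫ R.fst) (pullback.snd R.snd S.fst ≫ S.snd))

/-- `1_X ≤ R`, where `1_X` is the diagonal `⟨1_X, 1_X⟩ : X ↣ X × X`. -/
def Rel.IsReflexive (R : Rel X X) : Prop :=
  Subobject.mk (diag X) ≤ R

/-- `R° ≤ R`. -/
def Rel.IsSymmetric (R : Rel X X) : Prop :=
  R.opposite ≤ R

/-- `RR ≤ R`. -/
def Rel.IsTransitive (R : Rel X X) : Prop :=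
  Rel.comp R R ≤ R

/-- Internal equivalence relations on `X`. -/
structure Rel.IsEquivalence (R : Rel X X) : Prop where
  refl : R.IsReflexive
  symm : R.IsSymmetric
  trans : R.IsTransitive

variable (C) in
/-- A regular category is a Goursat category when it is 3-permutable: `RSR = SRS` for all
equivalence relations `R` and `S` on the same object. -/
def IsGoursat : Prop :=
  ∀ (X : C) (R S : Rel X X), R.IsEquivalence → S.IsEquivalence →
    Rel.comp R (Rel.comp S R) = Rel.comp S (Rel.comp R S)

end RegularRel

end

/-
An element of `S` is an arrow `x ⟶ u` with `(x, u) ∈ S`. Call two of them equivalent, `≈`, when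
their sources are related by `R ∧ T` and their targets by `R`, and write `∼` for having the same
target. As `S` is reflexive, it contains `(u, u)` and `(v, v)`, and these are joined by the chain
`(u, u) ∼ (x, u) ≈ (y, v) ∼ (v, v)`. By 3-permutability it can be turned around: on a cover of the
domain there are `(u, u) ≈ (a, c) ∼ (b, c) ≈ (v, v)`. Since `a R u R c`, the pair `(a, c)` lies in
`R ∧ S ≤ T`, so `u T a T c`; in the same way `v T b T c`.
-/

namespace RegularRel

variable {C : Type u} [Category.{v} C] {W X Y Z : C}

section Covers

theorem factors_of_strongEpi {P : Subobject X} {W' : C} (p : W' ⟶ W) [StrongEpi p] {h : W ⟶ X}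
    (hp : P.Factors (p ≫ h)) : P.Factors h := by
  have sq : CommSq (P.factorThru _ hp) p P.arrow h := ⟨P.factorThru_arrow _ hp⟩
  rw [← sq.fac_right]
  exact Subobject.factors_comp_arrow _

theorem imageSubobject_factors_iff [Regular C] {f : X ⟶ Y} {h : W ⟶ Y} :
    (imageSubobject f).Factors h ↔
      ∃ (W' : C) (p : W' ⟶ W) (_ : StrongEpi p) (l : W' ⟶ X), l ≫ f = p ≫ h := by
  constructor
  · intro hf
    let e := factorThruImageSubobject f
    let k := (imageSubobject f).factorThru h hf
    -- `e` is by definition the regular epimorphism `factorThruImage f` followed by an isomorphism.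
    have : IsRegularEpi e := inferInstanceAs (IsRegularEpi (_ ≫ _))
    refine ⟨_, pullback.fst k e, inferInstance, pullback.snd k e, ?_⟩
    calc pullback.snd k e ≫ f = pullback.snd k e ≫ e ≫ (imageSubobject f).arrow := by
          rw [imageSubobject_arrow_comp]
      _ = pullback.fst k e ≫ k ≫ (imageSubobject f).arrow := by rw [pullback.condition_assoc]
      _ = pullback.fst k e ≫ h := by rw [Subobject.factorThru_arrow]
  · rintro ⟨W', p, _, l, hl⟩
    exact factors_of_strongEpi p (hl ▸ imageSubobject_factors_comp_self f l)

end Covers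

variable [Regular C]

namespace Rel

section Membership

theorem mem_mk_lift {f : Z ⟶ X} {g : Z ⟶ Y} [Mono (prod.lift f g)] {x : W ⟶ X} {y : W ⟶ Y} :
    Rel.Mem (Subobject.mk (prod.lift f g)) x y ↔ ∃ k, k ≫ f = x ∧ k ≫ g = y := by
  change (∃ k : W ⟶ Z, k ≫ prod.lift f g = prod.lift x y) ↔ _
  simp only [prod.comp_lift, Limits.prod.hom_ext_iff, prod.lift_fst, prod.lift_snd]

theorem lift_fst_snd (R : Rel X Y) : prod.lift R.fst R.snd = R.arrow := by
  rw [← prod.comp_lift, prod.lift_fst_snd, Category.comp_id]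

theorem mem_iff_exists_lift {R : Rel X Y} {x : W ⟶ X} {y : W ⟶ Y} :
    R.Mem x y ↔ ∃ k, k ≫ R.fst = x ∧ k ≫ R.snd = y := by
  have : Mono (prod.lift R.fst R.snd) := by
    rw [lift_fst_snd]
    infer_instance
  rw [← mem_mk_lift]
  simp only [lift_fst_snd, Subobject.mk_arrow]

theorem Mem.precomp {R : Rel X Y} {x : W ⟶ X} {y : W ⟶ Y} (h : R.Mem x y) {W' : C}
    (p : W' ⟶ W) : R.Mem (p ≫ x) (p ≫ y) := by
  rw [Mem, ← prod.comp_lift]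
  exact Subobject.factors_of_factors_right p h

theorem Mem.of_strongEpi {R : Rel X Y} {x : W ⟶ X} {y : W ⟶ Y} {W' : C} (p : W' ⟶ W)
    [StrongEpi p] (h : R.Mem (p ≫ x) (p ≫ y)) : R.Mem x y := by
  rw [Mem, ← prod.comp_lift] at h
  exact factors_of_strongEpi p h

theorem mem_comp_fst_comp_snd (R : Rel X Y) (k : W ⟶ (R : C)) : R.Mem (k ≫ R.fst) (k ≫ R.snd) :=
  mem_iff_exists_lift.2 ⟨k, rfl, rfl⟩

theorem le_iff_mem {R S : Rel X Y} :
    R ≤ S ↔ ∀ ⦃W : C⦄ ⦃x : W ⟶ X⦄ ⦃y : W ⟶ Y⦄, R.Mem x y → S.Mem x y := by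
  refine ⟨fun h _ _ _ => Subobject.factors_of_le _ h, fun h => Subobject.le_of_factors ?_⟩
  rw [← lift_fst_snd]
  exact h (mem_iff_exists_lift.2 ⟨𝟙 _, Category.id_comp _, Category.id_comp _⟩)

theorem mem_inf {R S : Rel X Y} {x : W ⟶ X} {y : W ⟶ Y} :
    Rel.Mem (R ⊓ S) x y ↔ R.Mem x y ∧ S.Mem x y :=
  Subobject.inf_factors _

theorem mem_diag {x y : W ⟶ X} : Rel.Mem (Subobject.mk (diag X)) x y ↔ x = y := by
  simp only [mem_mk_lift, Category.comp_id, exists_eq_left]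

theorem mem_opposite {R : Rel X Y} {x : W ⟶ X} {y : W ⟶ Y} :
    R.opposite.Mem y x ↔ R.Mem x y := by
  rw [opposite, mem_mk_lift, mem_iff_exists_lift]
  simp only [and_comm]

theorem mem_comp {R : Rel X Y} {S : Rel Y Z} {x : W ⟶ X} {z : W ⟶ Z} :
    (Rel.comp S R).Mem x z ↔
      ∃ (W' : C) (p : W' ⟶ W) (_ : StrongEpi p) (y : W' ⟶ Y),
        R.Mem (p ≫ x) y ∧ S.Mem y (p ≫ z) := by
  rw [Mem, comp, imageSubobject_factors_iff]
  simp only [prod.comp_lift, Limits.prod.hom_ext_iff, prod.lift_fst, prod.lift_snd]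
  refine exists_congr fun W' => exists_congr fun p => exists_congr fun _ => ?_
  constructor
  · rintro ⟨l, hx, hz⟩
    refine ⟨l ≫ pullback.fst R.snd S.fst ≫ R.snd, ?_, ?_⟩
    · simpa only [← hx, Category.assoc] using
        R.mem_comp_fst_comp_snd (l ≫ pullback.fst R.snd S.fst)
    · simpa only [← hz, pullback.condition, Category.assoc] using
        S.mem_comp_fst_comp_snd (l ≫ pullback.snd R.snd S.fst)
  · rintro ⟨y, hxy, hyz⟩
    obtain ⟨k, hx, hy⟩ := mem_iff_exists_lift.1 hxy
    obtain ⟨m, hy', hz⟩ := mem_iff_exists_lift.1 hyz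
    refine ⟨pullback.lift k m (hy.trans hy'.symm), ?_, ?_⟩
    · rw [pullback.lift_fst_assoc, hx]
    · rw [pullback.lift_snd_assoc, hz]

theorem Mem.comp {R : Rel X Y} {S : Rel Y Z} {x : W ⟶ X} {y : W ⟶ Y} {z : W ⟶ Z}
    (hR : R.Mem x y) (hS : S.Mem y z) : (Rel.comp S R).Mem x z :=
  mem_comp.2 ⟨W, 𝟙 W, inferInstance, y, by rwa [Category.id_comp], by rwa [Category.id_comp]⟩

end Membership

section Equivalences

theorem isReflexive_iff_mem {R : Rel X X} :
    R.IsReflexive ↔ ∀ ⦃W : C⦄ (x : W ⟶ X), R.Mem x x := by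
  simp only [IsReflexive, le_iff_mem, mem_diag, forall_eq']

theorem isSymmetric_iff_mem {R : Rel X X} :
    R.IsSymmetric ↔ ∀ ⦃W : C⦄ ⦃x y : W ⟶ X⦄, R.Mem x y → R.Mem y x := by
  simp only [IsSymmetric, le_iff_mem, mem_opposite]
  exact forall_congr' fun _ => forall_comm

theorem isTransitive_iff_mem {R : Rel X X} :
    R.IsTransitive ↔ ∀ ⦃W : C⦄ ⦃x y z : W ⟶ X⦄, R.Mem x y → R.Mem y z → R.Mem x z := by
  rw [IsTransitive, le_iff_mem]
  refine ⟨fun h W x y z hxy hyz => h (hxy.comp hyz), fun h W x z hxz => ?_⟩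
  obtain ⟨W', p, _, y, hxy, hyz⟩ := mem_comp.1 hxz
  exact .of_strongEpi p (h hxy hyz)

theorem isEquivalence_iff_mem {R : Rel X X} :
    R.IsEquivalence ↔ ∀ W : C, _root_.Equivalence (R.Mem (W := W)) :=
  ⟨fun h _ => ⟨fun x => isReflexive_iff_mem.1 h.refl x, fun hxy => isSymmetric_iff_mem.1 h.symm hxy,
      fun hxy hyz => isTransitive_iff_mem.1 h.trans hxy hyz⟩,
    fun h => ⟨isReflexive_iff_mem.2 fun W => (h W).refl,
      isSymmetric_iff_mem.2 fun W _ _ => (h W).symm,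
      isTransitive_iff_mem.2 fun W _ _ _ => (h W).trans⟩⟩

theorem IsEquivalence.of_mem_iff {R : Rel X X} {r : ∀ W : C, (W ⟶ X) → (W ⟶ X) → Prop}
    (hr : ∀ W, _root_.Equivalence (r W)) (h : ∀ W (x y : W ⟶ X), R.Mem x y ↔ r W x y) :
    R.IsEquivalence := by
  refine isEquivalence_iff_mem.2 fun W => ?_
  rw [show R.Mem = r W from funext₂ fun x y => propext (h W x y)]
  exact hr W

theorem IsEquivalence.mem_symm {R : Rel X X} (hR : R.IsEquivalence) {x y : W ⟶ X}
    (h : R.Mem x y) : R.Mem y x :=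
  isSymmetric_iff_mem.1 hR.symm h

theorem IsEquivalence.mem_trans {R : Rel X X} (hR : R.IsEquivalence) {x y z : W ⟶ X}
    (h : R.Mem x y) (h' : R.Mem y z) : R.Mem x z :=
  isTransitive_iff_mem.1 hR.trans h h'

theorem IsEquivalence.inf {R S : Rel X X} (hR : R.IsEquivalence) (hS : S.IsEquivalence) :
    Rel.IsEquivalence (R ⊓ S) :=
  .of_mem_iff
    (fun W => (Setoid.mk _ (isEquivalence_iff_mem.1 hR W) ⊓
      Setoid.mk _ (isEquivalence_iff_mem.1 hS W)).iseqv)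
    fun _ _ _ => mem_inf

/-- The inverse image of a relation on `Y` along `f : X ⟶ Y`, as the pullback of subobjects along
`f × f`. It carries equivalence relations over to the object of a relation along its projections. -/
noncomputable def inverseImage (f : X ⟶ Y) (R : Rel Y Y) : Rel X X :=
  (Subobject.pullback (prod.map f f)).obj R

theorem mem_inverseImage {f : X ⟶ Y} {R : Rel Y Y} {x y : W ⟶ X} :
    (R.inverseImage f).Mem x y ↔ R.Mem (x ≫ f) (y ≫ f) := by
  rw [Mem, inverseImage, pullback_factors_iff, prod.lift_map, Mem]

theorem IsEquivalence.inverseImage {R : Rel Y Y} (hR : R.IsEquivalence) (f : X ⟶ Y) :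
    (R.inverseImage f).IsEquivalence :=
  .of_mem_iff (fun W => (isEquivalence_iff_mem.1 hR W).comap (· ≫ f)) fun _ _ _ => mem_inverseImage

/-- The kernel pair of `f`, as a relation on its domain: the inverse image of the diagonal. For the
second projection of a relation it identifies related pairs with the same target. -/
noncomputable def kernelPair (f : X ⟶ Y) : Rel X X :=
  Rel.inverseImage f (Subobject.mk (diag Y))

theorem mem_kernelPair {f : X ⟶ Y} {x y : W ⟶ X} : (kernelPair f).Mem x y ↔ x ≫ f = y ≫ f := by
  rw [kernelPair, mem_inverseImage, mem_diag]

theorem isEquivalence_kernelPair (f : X ⟶ Y) : (kernelPair f).IsEquivalence :=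
  .of_mem_iff (fun _ => eq_equivalence.comap (· ≫ f)) fun _ _ _ => mem_kernelPair

end Equivalences

end Rel

section Goursat

open RegularRel.Rel

theorem IsGoursat.exists_mem_mem_mem (hC : IsGoursat C) {R S : Rel X X} (hR : R.IsEquivalence)
    (hS : S.IsEquivalence) {a b c d : W ⟶ X} (hab : R.Mem a b) (hbc : S.Mem b c)
    (hcd : R.Mem c d) :
    ∃ (W' : C) (p : W' ⟶ W) (_ : StrongEpi p) (b' c' : W' ⟶ X),
      S.Mem (p ≫ a) b' ∧ R.Mem b' c' ∧ S.Mem c' (p ≫ d) := by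
  have h : (Rel.comp R (Rel.comp S R)).Mem a d := (hab.comp hbc).comp hcd
  rw [hC X R S hR hS] at h
  obtain ⟨W₁, p, _, c', hac', hc'd⟩ := mem_comp.1 h
  obtain ⟨W₂, q, _, b', hab', hb'c'⟩ := mem_comp.1 hac'
  refine ⟨W₂, q ≫ p, strongEpi_comp q p, b', q ≫ c', ?_, hb'c', ?_⟩
  · rwa [Category.assoc]
  · rw [Category.assoc]
    exact hc'd.precomp q

/-- `KEK ≤ EKE` spelled out on elements, where `K` is the kernel pair of `S.snd` and `E` is the
equivalence relation on the object `S` given by `P` on sources and `Q` on targets. -/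
theorem IsGoursat.exists_common_target (hC : IsGoursat C) {P : Rel X X} {Q : Rel Y Y}
    (hP : P.IsEquivalence) (hQ : Q.IsEquivalence) {S : Rel X Y} {x x' y y' : W ⟶ X} {u v : W ⟶ Y}
    (hxu : S.Mem x u) (hyv : S.Mem y v) (hxy : P.Mem x y) (huv : Q.Mem u v)
    (hx'u : S.Mem x' u) (hy'v : S.Mem y' v) :
    ∃ (W' : C) (p : W' ⟶ W) (_ : StrongEpi p) (a b : W' ⟶ X) (c : W' ⟶ Y),
      (P.Mem (p ≫ x') a ∧ S.Mem a c ∧ Q.Mem (p ≫ u) c) ∧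
        (P.Mem (p ≫ y') b ∧ S.Mem b c ∧ Q.Mem (p ≫ v) c) := by
  let E : Rel (S : C) (S : C) := P.inverseImage S.fst ⊓ Q.inverseImage S.snd
  have hE : E.IsEquivalence := (hP.inverseImage _).inf (hQ.inverseImage _)
  have memE {V : C} {s t : V ⟶ (S : C)} :
      E.Mem s t ↔ P.Mem (s ≫ S.fst) (t ≫ S.fst) ∧ Q.Mem (s ≫ S.snd) (t ≫ S.snd) := by
    rw [mem_inf, mem_inverseImage, mem_inverseImage]
  obtain ⟨xu, rfl, rfl⟩ := mem_iff_exists_lift.1 hxu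
  obtain ⟨yv, rfl, rfl⟩ := mem_iff_exists_lift.1 hyv
  obtain ⟨x'u, rfl, hu⟩ := mem_iff_exists_lift.1 hx'u
  obtain ⟨y'v, rfl, hv⟩ := mem_iff_exists_lift.1 hy'v
  obtain ⟨W', p, hp, s, t, hs, hst, ht⟩ :=
    hC.exists_mem_mem_mem (isEquivalence_kernelPair S.snd) hE (mem_kernelPair.2 hu)
      (memE.2 ⟨hxy, huv⟩) (mem_kernelPair.2 hv.symm)
  rw [mem_kernelPair] at hst
  obtain ⟨hPs, hQs⟩ := memE.1 hs
  obtain ⟨hPt, hQt⟩ := memE.1 (hE.mem_symm ht)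
  rw [Category.assoc] at hPs hQs hPt hQt
  rw [hu] at hQs
  rw [hv] at hQt
  refine ⟨W', p, hp, s ≫ S.fst, t ≫ S.fst, s ≫ S.snd,
    ⟨hPs, S.mem_comp_fst_comp_snd s, hQs⟩, ?_⟩
  rw [hst]
  exact ⟨hPt, S.mem_comp_fst_comp_snd t, hQt⟩

end Goursat

end RegularRel

open RegularRel Rel in
theorem proposition3p4 {C : Type u} [Category.{v} C] [Regular C] (hC : RegularRel.IsGoursat C)
    {X : C} (R S T : RegularRel.Rel X X)
    (hR : R.IsEquivalence) (hS : S.IsReflexive) (hT : T.IsEquivalence)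
    (hRST : R ⊓ S ≤ T)
    {W : C} (x y u v : W ⟶ X)
    (hxy : RegularRel.Rel.Mem (R ⊓ T) x y) (hxu : S.Mem x u) (hyv : S.Mem y v)
    (huv : R.Mem u v) :
    T.Mem u v := by
  obtain ⟨W', p, _, a, b, c, hu, hv⟩ :=
    hC.exists_common_target (hR.inf hT) hR hxu hyv hxy huv
      (isReflexive_iff_mem.1 hS u) (isReflexive_iff_mem.1 hS v)
  have mem_target {w a : W' ⟶ X} (h : Rel.Mem (R ⊓ T) w a ∧ S.Mem a c ∧ R.Mem w c) :
      T.Mem w c := by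
    obtain ⟨hwa, hac, hwc⟩ := h
    obtain ⟨hwa_R, hwa_T⟩ := mem_inf.1 hwa
    have hac_R : R.Mem a c := hR.mem_trans (hR.mem_symm hwa_R) hwc
    exact hT.mem_trans hwa_T (le_iff_mem.1 hRST (mem_inf.2 ⟨hac_R, hac⟩))
  exact .of_strongEpi p (hT.mem_trans (mem_target hu) (hT.mem_symm (mem_target hv)))
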